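/- Let $d\ge 2$ be an integer and $0<\alpha\le 2$. For $t>0$ let $p_t^{(\alpha)}(x,y)=p_t^{(\alpha)}(x-y)$ be the transition density of the rotationally invariant $\alpha$-stable process in $\mathbb R^d$, that is, $$p_t^{(\alpha)}(z)=(2\pi)^{-d}\int_{\mathbb R^d}e^{i\xi\cdot z}e^{-t|\xi|^\alpha}\,d\xi .$$ For $t>0$ and $x,y\in\mathbb R^d$ let $\mathbb P^t_{x,y}$ (with expectation $\mathbb E^t_{x,y}$) be the law of the $\alpha$-stable bridge from $x$ to $y$ of length $t$: under $\mathbb P^t_{x,y}$ the process $(X_s)_{0\le s\le t}$ has almost surely càdlàg paths, $X_0=x$ and $X_t=y$ almost surely, and for $0<s_1<\dots<s_k<t$ the vector $(X_{s_1},\dots,X_{s_k})$ has the density $$\frac{1}{p_t^{(\alpha)}(x,y)}\,p_{s_1}^{(\alpha)}(x,z_1)\Big(\prod_{j=1}^{k-1}p_{s_{j+1}-s_j}^{(\alpha)}(z_j,z_{j+1})\Big)p_{t-s_k}^{(\alpha)}(z_k,y).$$ Let $\Omega\subseteq\mathbb R^d$ be a Lebesgue measurable set of finite Lebesgue measure $|\Omega|$.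 The heat content for the Schrödinger operator $(-\Delta)^{\alpha/2}+\mathbf 1_\Omega$ is $$\Psi_\Omega^{(\alpha)}(t)=\int_{\mathbb R^d}dx\int_{\mathbb R^d}dy\,p_t^{(\alpha)}(x,y)\Big(1-\mathbb E^t_{x,y}\Big[e^{-\int_0^t \mathbf 1_\Omega(X_s)\,ds}\Big]\Big),$$ and we put $$T_\Omega^{(1)}(t)=\int_{\mathbb R^d}dx\int_{\mathbb R^d}dy\,p_t^{(\alpha)}(x,y)\,\mathbb E^t_{x,y}\Big[\int_0^t \mathbf 1_\Omega(X_s)\,ds\Big],$$ with $\Psi_\Omega^{(\alpha)}(0)=T_\Omega^{(1)}(0)=0$. Then, for all $t\ge 0$, both double integrals converge absolutely (as integrals over $\mathbb R^d\times\mathbb R^d$), $$0\le\Psi_\Omega^{(\alpha)}(t)\le t\,|\Omega| ,\qquad\text{and}\qquad T_\Omega^{(1)}(t)=t\,|\Omega| .$$ -/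

import Mathlib

open MeasureTheory Filter Topology

namespace StableHeat

/-- The density `p_t^{(α)}(z)` of the rotationally invariant `α`-stable process in `ℝ^d`, i.e. the
inverse Fourier transform
`(2π)^{-d} ∫ e^{i ξ·z} e^{-t |ξ|^α} dξ` of `ξ ↦ e^{-t |ξ|^α}` (`t > 0`). -/
noncomputable def stableDensity (d : ℕ) (α t : ℝ) (z : EuclideanSpace ℝ (Fin d)) : ℝ :=
  (((2 * Real.pi) ^ d)⁻¹ : ℝ) *
    (∫ ξ : EuclideanSpace ℝ (Fin d),
      Complex.exp (((inner ℝ ξ z : ℝ) : ℂ) * Complex.I) *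
        ((Real.exp (-t * ‖ξ‖ ^ α) : ℝ) : ℂ)).re

/-- The transition density (heat kernel) `p_t^{(α)}(x, y) = p_t^{(α)}(x - y)`. -/
noncomputable def heatKernel (d : ℕ) (α t : ℝ) (x y : EuclideanSpace ℝ (Fin d)) : ℝ :=
  stableDensity d α t (x - y)

/-- The joint density at `(z_1, …, z_{k+1})` of the bridge from `x` to `y` of length `t`, observed
at the times `0 < s_1 < ⋯ < s_{k+1} < t`. -/
noncomputable def bridgeDensity (d : ℕ) (α t : ℝ) (x y : EuclideanSpace ℝ (Fin d)) (k : ℕ)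
    (s : Fin (k + 1) → ℝ) (z : Fin (k + 1) → EuclideanSpace ℝ (Fin d)) : ℝ :=
  heatKernel d α (s 0) x (z 0) *
    (∏ j : Fin k, heatKernel d α (s j.succ - s j.castSucc) (z j.castSucc) (z j.succ)) *
    heatKernel d α (t - s (Fin.last k)) (z (Fin.last k)) y / heatKernel d α t x y

/-- Under the probability measure `P`, the process `(X_s)_{0 ≤ s ≤ t}` is an `α`-stable bridge
from `x` to `y` of length `t`: it has càdlàg paths, starts at `x`, is at `y` at time `t`, and has
the finite dimensional distributions of the bridge. -/
structure IsStableBridge {W : Type*} [MeasurableSpace W] (d : ℕ) (α t : ℝ)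
    (x y : EuclideanSpace ℝ (Fin d)) (X : ℝ → W → EuclideanSpace ℝ (Fin d))
    (P : Measure W) : Prop where
  isProbabilityMeasure : IsProbabilityMeasure P
  measurable : ∀ s ∈ Set.Icc 0 t, Measurable (X s)
  rightCont : ∀ᵐ w ∂P, ∀ s ∈ Set.Ico 0 t, Tendsto (fun r => X r w) (𝓝[>] s) (𝓝 (X s w))
  leftLim : ∀ᵐ w ∂P, ∀ s ∈ Set.Ioc 0 t, ∃ l, Tendsto (fun r => X r w) (𝓝[<] s) (𝓝 l)
  start : ∀ᵐ w ∂P, X 0 w = x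
  finish : ∀ᵐ w ∂P, X t w = y
  fdd : ∀ (k : ℕ) (s : Fin (k + 1) → ℝ), StrictMono s → (∀ i, s i ∈ Set.Ioo 0 t) →
    P.map (fun w i => X (s i) w) =
      (volume : Measure (Fin (k + 1) → EuclideanSpace ℝ (Fin d))).withDensity
        (fun z => ENNReal.ofReal (bridgeDensity d α t x y k s z))

/-- The occupation time `∫_0^t 𝟙_D(X_s) ds`. -/
noncomputable def occupationTime {W : Type*} {d : ℕ} (X : ℝ → W → EuclideanSpace ℝ (Fin d))
    (D : Set (EuclideanSpace ℝ (Fin d))) (t : ℝ) (w : W) : ℝ :=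
  ∫ s in (0 : ℝ)..t, D.indicator (fun _ => (1 : ℝ)) (X s w)

/-- The integrand `p_t(x,y) (1 - E^t_{x,y}[exp (-∫_0^t 𝟙_D(X_s) ds)])` of the heat content. Here
`P t x y` is the law of the bridge from `x` to `y` of length `t`. -/
noncomputable def heatContentIntegrand {W : Type*} [MeasurableSpace W] (d : ℕ) (α : ℝ)
    (X : ℝ → W → EuclideanSpace ℝ (Fin d))
    (P : ℝ → EuclideanSpace ℝ (Fin d) → EuclideanSpace ℝ (Fin d) → Measure W)
    (D : Set (EuclideanSpace ℝ (Fin d))) (t : ℝ) (x y : EuclideanSpace ℝ (Fin d)) : ℝ :=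
  heatKernel d α t x y * (1 - ∫ w, Real.exp (-occupationTime X D t w) ∂(P t x y))

/-- The heat content `Ψ_D^{(α)}(t)` for the Schrödinger operator `(-Δ)^{α/2} + 𝟙_D`. -/
noncomputable def schrodingerHeatContent {W : Type*} [MeasurableSpace W] (d : ℕ) (α : ℝ)
    (X : ℝ → W → EuclideanSpace ℝ (Fin d))
    (P : ℝ → EuclideanSpace ℝ (Fin d) → EuclideanSpace ℝ (Fin d) → Measure W)
    (D : Set (EuclideanSpace ℝ (Fin d))) (t : ℝ) : ℝ :=
  ∫ x, ∫ y, heatContentIntegrand d α X P D t x y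

/-- The integrand `p_t(x,y) E^t_{x,y}[(∫_0^t 𝟙_D(X_s) ds)^k]` of `T_D^{(k)}(t)`. -/
noncomputable def occupationMomentIntegrand {W : Type*} [MeasurableSpace W] (d : ℕ) (α : ℝ)
    (X : ℝ → W → EuclideanSpace ℝ (Fin d))
    (P : ℝ → EuclideanSpace ℝ (Fin d) → EuclideanSpace ℝ (Fin d) → Measure W)
    (D : Set (EuclideanSpace ℝ (Fin d))) (k : ℕ) (t : ℝ)
    (x y : EuclideanSpace ℝ (Fin d)) : ℝ :=
  heatKernel d α t x y * ∫ w, (occupationTime X D t w) ^ k ∂(P t x y)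

/-- `T_D^{(k)}(t) = ∫∫ p_t(x,y) E^t_{x,y}[(∫_0^t 𝟙_D(X_s) ds)^k] dy dx`. -/
noncomputable def occupationMoment {W : Type*} [MeasurableSpace W] (d : ℕ) (α : ℝ)
    (X : ℝ → W → EuclideanSpace ℝ (Fin d))
    (P : ℝ → EuclideanSpace ℝ (Fin d) → EuclideanSpace ℝ (Fin d) → Measure W)
    (D : Set (EuclideanSpace ℝ (Fin d))) (k : ℕ) (t : ℝ) : ℝ :=
  ∫ x, ∫ y, occupationMomentIntegrand d α X P D k t x y

end StableHeat

/-!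
The occupation time `A = ∫₀ᵗ 𝟙_D(X_s) ds` of the bridge from `x` to `y` has, by Fubini, the
expectation `∫₀ᵗ P(X_s ∈ D) ds`, and `p_t(x, y) P(X_s ∈ D) = ∫_D p_s(x, z) p_{t-s}(z, y) dz`.
Integrating over `x` and `y`, using Tonelli and the fact that the kernels have total mass one, gives
`t |D|` (`lintegral_heatKernel_mul_heatKernel`). The heat content is then controlled by
`0 ≤ 1 - e^{-A} ≤ A`.

Three points carry the proof.

* Mass one and positivity of `p_t`. The density `p_t` is, up to scaling, the Fourier transform of the
  integrable continuous function `e^{-t|ξ|^α}`; as soon as such a transform is nonnegative its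
  integral is the value of the function at the origin, by Gaussian regularisation and monotone
  convergence (`lintegral_re_fourier`). For positivity: the bridge marginals are probability
  measures with a density divided by `p_t(x, y)`, so `p_t` has no zero, and it is continuous and
  positive at the origin (`stableDensity_pos`).
* The time integral. Right-continuity recovers `X_s` as a limit of values on a countable grid of
  times in `(0, t)` (`pathEval`). This provides a jointly measurable version of `(s, w) ↦ X_s(w)` and
  expresses the occupation time as a measurable functional of the path in the product space of
  functions `(0, t) → ℝ^d` (`IsStableBridge.occupationTime_ae_eq`). The set `D` may be replaced by a
  Borel set here, since the bridge almost surely spends no time in a given null set.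
* Measurability in the end points. On that product space the laws of the bridges form a kernel in
  `(x, y)`: on cylinder sets they are integrals of jointly measurable densities, and cylinder sets
  form a generating `π`-system (`measurable_map_openPath`).
-/

namespace StableHeat

open scoped FourierTransform

/-! ### Nonnegative Fourier transforms of integrable functions -/

section FourierMass

variable {V : Type*} [NormedAddCommGroup V] [InnerProductSpace ℝ V] [MeasurableSpace V]
  [BorelSpace V] [FiniteDimensional ℝ V] {f : V → ℂ}

/-- The Gaussian means of `𝓕 f` converge to `f 0`: moving the Fourier transform to the Gaussian turns
them into averages of `f` against an approximate identity. No integrability of `𝓕 f` is needed. -/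
theorem tendsto_integral_gaussian_mul_fourier (hf : Integrable f) (h0 : ContinuousAt f 0) :
    Tendsto (fun c : ℝ => ∫ w : V, Complex.exp (-(c⁻¹ : ℂ) * ‖w‖ ^ 2) * 𝓕 f w) atTop
      (𝓝 (f 0)) := by
  refine (Real.tendsto_integral_gaussian_smul' hf h0).congr' ?_
  filter_upwards [Ioi_mem_atTop 0] with c (hc : 0 < c)
  have J : Integrable (fun w : V ↦ Complex.exp (-(c⁻¹ : ℂ) * ‖w‖ ^ 2
      + 2 * Real.pi * Complex.I * (inner ℝ (0 : V) w : ℝ))) :=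
    GaussianFourier.integrable_cexp_neg_mul_sq_norm_add
      (by rw [← Complex.ofReal_inv, Complex.ofReal_re]; positivity) _ _
  have key : ∫ w : V, 𝓕 (fun w : V ↦ Complex.exp (-(c⁻¹ : ℂ) * ‖w‖ ^ 2
      + 2 * Real.pi * Complex.I * (inner ℝ (0 : V) w : ℝ))) w • f w
      = ∫ w : V, Complex.exp (-(c⁻¹ : ℂ) * ‖w‖ ^ 2
      + 2 * Real.pi * Complex.I * (inner ℝ (0 : V) w : ℝ)) • 𝓕 f w := by
    simpa using! (VectorFourier.integral_fourierIntegral_smul_eq_flip (L := innerₗ V)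
      Real.continuous_fourierChar continuous_inner J hf)
  calc _ = _ := ?_
    _ = _ := key
    _ = _ := by simp
  congr with w
  rw [fourier_gaussian_innerProductSpace'
    (by rw [← Complex.ofReal_inv, Complex.ofReal_re]; positivity)]
  simp only [div_inv_eq_mul]
  congr 3
  ring

theorem continuous_fourier_of_integrable (hf : Integrable f) : Continuous (𝓕 f) :=
  VectorFourier.fourierIntegral_continuous Real.continuous_fourierChar continuous_inner hf

/-- If the Fourier transform of `f` has nonnegative real part, then that real part is integrable with
total mass `Re f(0)`, because the Gaussian means of the transform increase to its integral. -/
theorem lintegral_re_fourier (hf : Integrable f) (h0 : ContinuousAt f 0)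
    (hpos : ∀ v, 0 ≤ (𝓕 f v).re) :
    ∫⁻ v, ENNReal.ofReal (𝓕 f v).re = ENNReal.ofReal (f 0).re := by
  have hcont := continuous_fourier_of_integrable hf
  have hb : ∀ v, ‖𝓕 f v‖ ≤ ∫ w, ‖f w‖ := fun v =>
    VectorFourier.norm_fourierIntegral_le_integral_norm _ _ _ _ _
  -- the integrand of the Gaussian mean with parameter `n + 1`, which increases with `n`
  set F : ℕ → V → ℝ := fun n v => Real.exp (-((n : ℝ) + 1)⁻¹ * ‖v‖ ^ 2) * (𝓕 f v).re with hF
  have hFre : ∀ n v, F n v =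
      (Complex.exp (-(((n : ℝ) + 1 : ℝ)⁻¹ : ℂ) * ‖v‖ ^ 2) * 𝓕 f v).re := by
    intro n v
    rw [← Complex.ofReal_inv, ← Complex.ofReal_pow, ← Complex.ofReal_neg, ← Complex.ofReal_mul,
      ← Complex.ofReal_exp, Complex.re_ofReal_mul]
  have hint : ∀ n : ℕ, Integrable
      (fun v => Complex.exp (-(((n : ℝ) + 1 : ℝ)⁻¹ : ℂ) * ‖v‖ ^ 2) * 𝓕 f v) := by
    intro n
    have J : Integrable (fun v : V => Complex.exp (-(((n : ℝ) + 1 : ℝ)⁻¹ : ℂ) * ‖v‖ ^ 2)) := by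
      have := GaussianFourier.integrable_cexp_neg_mul_sq_norm_add (V := V)
        (b := (((n : ℝ) + 1 : ℝ)⁻¹ : ℂ))
        (by rw [← Complex.ofReal_inv, Complex.ofReal_re]; positivity) 0 0
      simpa using this
    exact J.mul_bdd hcont.aestronglyMeasurable (ae_of_all _ hb)
  have hF0 : ∀ n v, 0 ≤ F n v := fun n v => mul_nonneg (Real.exp_pos _).le (hpos v)
  have hlim : Tendsto (fun n => ENNReal.ofReal (∫ v, F n v)) atTop
      (𝓝 (ENNReal.ofReal (f 0).re)) := by
    refine ENNReal.tendsto_ofReal ?_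
    have h1 := (tendsto_integral_gaussian_mul_fourier hf h0).comp
      (tendsto_atTop_add_const_right _ (1 : ℝ) tendsto_natCast_atTop_atTop)
    have h2 := (Complex.continuous_re.tendsto _).comp h1
    refine h2.congr fun n => ?_
    simp only [Function.comp_def, hFre]
    exact (integral_re (hint n)).symm
  refine tendsto_nhds_unique ?_ hlim
  have hconv : ∀ n, ENNReal.ofReal (∫ v, F n v) = ∫⁻ v, ENNReal.ofReal (F n v) := fun n =>
    ofReal_integral_eq_lintegral_ofReal
      ((hint n).re.congr (ae_of_all _ fun v => (hFre n v).symm)) (ae_of_all _ (hF0 n))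
  simp only [hconv]
  refine lintegral_tendsto_of_tendsto_of_monotone ?_ ?_ ?_
  · intro n
    have : Continuous (F n) := by
      have := Complex.continuous_re.comp hcont
      simp only [hF, Function.comp_def] at this ⊢
      fun_prop
    exact this.measurable.ennreal_ofReal.aemeasurable
  · refine ae_of_all _ fun v n m hnm => ENNReal.ofReal_le_ofReal ?_
    refine mul_le_mul_of_nonneg_right (Real.exp_le_exp.2 ?_) (hpos v)
    refine mul_le_mul_of_nonneg_right (neg_le_neg ?_) (by positivity)
    have : (n : ℝ) ≤ m := by exact_mod_cast hnm
    gcongr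
  · refine ae_of_all _ fun v => ENNReal.tendsto_ofReal ?_
    have h1 : Tendsto (fun n : ℕ => ((n : ℝ) + 1)⁻¹) atTop (𝓝 0) :=
      tendsto_inv_atTop_zero.comp
        (tendsto_atTop_add_const_right _ (1 : ℝ) tendsto_natCast_atTop_atTop)
    have h2 := ((Real.continuous_exp.tendsto _).comp (h1.neg.mul_const (‖v‖ ^ 2))).mul_const
      (𝓕 f v).re
    simpa [hF, Function.comp_def] using h2

end FourierMass

/-! ### The stable density -/

section Density

variable {d : ℕ} {α t : ℝ}

theorem integrable_exp_neg_mul_norm_rpow (hd : 0 < d) (hα : 0 < α) (ht : 0 < t) :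
    Integrable (fun ξ : EuclideanSpace ℝ (Fin d) => Real.exp (-t * ‖ξ‖ ^ α)) := by
  have : Nonempty (Fin d) := ⟨⟨0, hd⟩⟩
  have : Nontrivial (EuclideanSpace ℝ (Fin d)) := inferInstance
  rw [integrable_fun_norm_addHaar (volume : Measure (EuclideanSpace ℝ (Fin d)))
    (f := fun r : ℝ => Real.exp (-t * r ^ α))]
  have := integrableOn_rpow_mul_exp_neg_mul_rpow (p := α) (s := ((d - 1 : ℕ) : ℝ)) (b := t)
    (by have : (0 : ℝ) ≤ ((d - 1 : ℕ) : ℝ) := by positivity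
        linarith) hα ht
  simpa [Real.rpow_natCast] using this

/-- The character `e^{iξ·z}` in `stableDensity` is Mathlib's `e^{-2πi ξ·v}` for `v = -z / (2π)`. -/
theorem stableDensity_eq_fourier (z : EuclideanSpace ℝ (Fin d)) :
    stableDensity d α t z = ((2 * Real.pi) ^ d)⁻¹ *
      (𝓕 (fun ξ : EuclideanSpace ℝ (Fin d) => ((Real.exp (-t * ‖ξ‖ ^ α) : ℝ) : ℂ))
        ((-(2 * Real.pi)⁻¹) • z)).re := by
  rw [stableDensity, Real.fourier_eq']
  congr 3
  ext ξ
  rw [smul_eq_mul]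
  congr 2
  rw [inner_smul_right]
  push_cast
  have : (Real.pi : ℂ) ≠ 0 := by exact_mod_cast Real.pi_ne_zero
  field_simp

theorem continuous_stableDensity (hd : 0 < d) (hα : 0 < α) (ht : 0 < t) :
    Continuous (stableDensity d α t) := by
  have h := continuous_fourier_of_integrable
    ((integrable_exp_neg_mul_norm_rpow (d := d) hd hα ht).ofReal (𝕜 := ℂ))
  have h2 : Continuous fun z : EuclideanSpace ℝ (Fin d) => (-(2 * Real.pi)⁻¹) • z := by fun_prop
  have := (Complex.continuous_re.comp (h.comp h2)).const_mul ((2 * Real.pi) ^ d)⁻¹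
  refine this.congr fun z => (stableDensity_eq_fourier z).symm

theorem stableDensity_zero_pos (hd : 0 < d) (hα : 0 < α) (ht : 0 < t) :
    0 < stableDensity d α t 0 := by
  have hi := integrable_exp_neg_mul_norm_rpow (d := d) hd hα ht
  have : 0 < ∫ ξ : EuclideanSpace ℝ (Fin d), Real.exp (-t * ‖ξ‖ ^ α) := integral_exp_pos hi
  simp only [stableDensity, inner_zero_right, Complex.ofReal_zero, zero_mul, Complex.exp_zero,
    one_mul]
  rw [integral_complex_ofReal, Complex.ofReal_re]
  positivity

/-- A nonnegative stable density has total mass `e^{-t|0|^α} = 1`. -/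
theorem lintegral_stableDensity (hd : 0 < d) (hα : 0 < α) (ht : 0 < t)
    (hpos : ∀ z, 0 ≤ stableDensity d α t z) :
    ∫⁻ z, ENNReal.ofReal (stableDensity d α t z) = 1 := by
  have hpi : 0 < 2 * Real.pi := by positivity
  set f : EuclideanSpace ℝ (Fin d) → ℂ := fun ξ => ((Real.exp (-t * ‖ξ‖ ^ α) : ℝ) : ℂ) with hf
  have hfi : Integrable f := (integrable_exp_neg_mul_norm_rpow hd hα ht).ofReal
  have hfc : Continuous f := by
    refine Complex.continuous_ofReal.comp (Real.continuous_exp.comp (continuous_const.mul ?_))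
    exact continuous_norm.rpow_const fun _ => Or.inr hα.le
  have hp : ∀ v, 0 ≤ (𝓕 f v).re := by
    intro v
    have h := hpos ((-(2 * Real.pi)) • v)
    rw [stableDensity_eq_fourier, smul_smul, neg_mul_neg, inv_mul_cancel₀ hpi.ne', one_smul] at h
    exact nonneg_of_mul_nonneg_right h (by positivity)
  have hl := lintegral_re_fourier hfi hfc.continuousAt hp
  have hf0 : (f 0).re = 1 := by simp [hf, Real.zero_rpow hα.ne']
  rw [hf0, ENNReal.ofReal_one] at hl
  have hm : Continuous fun v => (𝓕 f v).re :=
    Complex.continuous_re.comp (continuous_fourier_of_integrable hfi)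
  have hfin : Integrable fun v => (𝓕 f v).re := by
    refine ⟨hm.aestronglyMeasurable, ?_⟩
    rw [hasFiniteIntegral_iff_ofReal (ae_of_all _ hp), hl]
    exact ENNReal.one_lt_top
  have hi1 : ∫ v, (𝓕 f v).re = 1 := by
    rw [integral_eq_lintegral_of_nonneg_ae (ae_of_all _ hp) hm.aestronglyMeasurable, hl,
      ENNReal.toReal_one]
  have hR : -(2 * Real.pi)⁻¹ ≠ 0 := neg_ne_zero.2 (inv_ne_zero hpi.ne')
  have hi : Integrable (stableDensity d α t) := by
    have := (hfin.comp_smul hR).const_mul ((2 * Real.pi) ^ d)⁻¹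
    exact this.congr (ae_of_all _ fun z => (stableDensity_eq_fourier z).symm)
  rw [← ofReal_integral_eq_lintegral_ofReal hi (ae_of_all _ hpos)]
  simp only [stableDensity_eq_fourier]
  rw [integral_const_mul, Measure.integral_comp_smul volume (fun v => (𝓕 f v).re), hi1]
  have : |((-(2 * Real.pi)⁻¹) ^ d)⁻¹| = (2 * Real.pi) ^ d := by
    rw [abs_inv, abs_pow, abs_neg, abs_inv, abs_of_pos hpi, inv_pow, inv_inv]
  rw [finrank_euclideanSpace_fin, this, smul_eq_mul, mul_one,
    inv_mul_cancel₀ (by positivity), ENNReal.ofReal_one]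

/-- At `t = 0` the integrand of `stableDensity` has constant norm one, hence is not integrable, and
the Bochner integral takes its default value. -/
theorem stableDensity_zero_time (hd : 0 < d) (z : EuclideanSpace ℝ (Fin d)) :
    stableDensity d α 0 z = 0 := by
  have : Nonempty (Fin d) := ⟨⟨0, hd⟩⟩
  have : Nontrivial (EuclideanSpace ℝ (Fin d)) := inferInstance
  rw [stableDensity, integral_undef, Complex.zero_re, mul_zero]
  intro h
  have := h.norm
  simp [Complex.norm_exp, integrable_const_iff, isFiniteMeasure_iff] at this

theorem measurable_stableDensity_uncurry (d : ℕ) (α : ℝ) :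
    Measurable fun q : ℝ × EuclideanSpace ℝ (Fin d) => stableDensity d α q.1 q.2 := by
  have h : StronglyMeasurable fun q : ℝ × EuclideanSpace ℝ (Fin d) =>
      ∫ ξ : EuclideanSpace ℝ (Fin d), Complex.exp (((inner ℝ ξ q.2 : ℝ) : ℂ) * Complex.I) *
        ((Real.exp (-q.1 * ‖ξ‖ ^ α) : ℝ) : ℂ) := by
    refine StronglyMeasurable.integral_prod_right
      (f := fun (q : ℝ × EuclideanSpace ℝ (Fin d)) (ξ : EuclideanSpace ℝ (Fin d)) =>
        Complex.exp (((inner ℝ ξ q.2 : ℝ) : ℂ) * Complex.I) *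
        ((Real.exp (-q.1 * ‖ξ‖ ^ α) : ℝ) : ℂ)) (Measurable.stronglyMeasurable ?_)
    unfold Function.uncurry
    fun_prop
  exact (Complex.measurable_re.comp h.measurable).const_mul _

theorem measurable_heatKernel {ι : Type*} [MeasurableSpace ι] {τ : ι → ℝ}
    {x y : ι → EuclideanSpace ℝ (Fin d)} (hτ : Measurable τ) (hx : Measurable x)
    (hy : Measurable y) : Measurable fun i => heatKernel d α (τ i) (x i) (y i) := by
  have h : Measurable fun i => x i - y i := hx.sub hy
  have h' : Measurable fun i => (τ i, x i - y i) := hτ.prodMk h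
  have := (measurable_stableDensity_uncurry d α).comp h'
  simpa only [Function.comp_def, heatKernel] using this

end Density

/-! ### Jointly measurable evaluation of right-continuous paths -/

section PathEvaluation

variable {t : ℝ}

/-- The point `(j + 1) / (n + 1)` of the grid of mesh `1 / (n + 1)`, as an element of `(0, t)`;
grid points outside `(0, t)` are replaced by `t / 2`. -/
noncomputable def gridPoint (ht : 0 < t) (n j : ℕ) : Set.Ioo 0 t :=
  open Classical in
  if h : ((j : ℝ) + 1) / ((n : ℝ) + 1) ∈ Set.Ioo 0 t then ⟨_, h⟩
  else ⟨t / 2, half_pos ht, half_lt_self ht⟩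

theorem tendsto_gridPoint_nhdsGT (ht : 0 < t) {s : ℝ} (hs : s ∈ Set.Ioo 0 t) :
    Tendsto (fun n : ℕ => (gridPoint ht n ⌊((n : ℝ) + 1) * s⌋₊ : ℝ)) atTop (𝓝[>] s) := by
  have hlow : ∀ n : ℕ, s < ((⌊((n : ℝ) + 1) * s⌋₊ : ℝ) + 1) / ((n : ℝ) + 1) := by
    intro n
    rw [lt_div_iff₀ (by positivity), mul_comm]
    exact Nat.lt_floor_add_one _
  have hup : ∀ n : ℕ, ((⌊((n : ℝ) + 1) * s⌋₊ : ℝ) + 1) / ((n : ℝ) + 1)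
      ≤ s + 1 / ((n : ℝ) + 1) := by
    intro n
    have h1 : (0 : ℝ) < (n : ℝ) + 1 := by positivity
    have h2 := Nat.floor_le (mul_nonneg h1.le hs.1.le)
    rw [div_le_iff₀ h1, add_mul s, one_div, inv_mul_cancel₀ h1.ne']
    linarith
  have hlim : Tendsto (fun n : ℕ => ((⌊((n : ℝ) + 1) * s⌋₊ : ℝ) + 1) / ((n : ℝ) + 1)) atTop
      (𝓝 s) := by
    refine tendsto_of_tendsto_of_tendsto_of_le_of_le tendsto_const_nhds ?_
      (fun n => (hlow n).le) hup
    simpa using tendsto_const_nhds.add (tendsto_one_div_add_atTop_nhds_zero_nat (𝕜 := ℝ))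
  have hev : ∀ᶠ n : ℕ in atTop, ((⌊((n : ℝ) + 1) * s⌋₊ : ℝ) + 1) / ((n : ℝ) + 1)
      = (gridPoint ht n ⌊((n : ℝ) + 1) * s⌋₊ : ℝ) := by
    filter_upwards [hlim.eventually (gt_mem_nhds hs.2)] with n hn
    rw [gridPoint, dif_pos ⟨hs.1.trans (hlow n), hn⟩]
  refine Tendsto.congr' hev (tendsto_nhdsWithin_iff.2 ⟨hlim, Eventually.of_forall hlow⟩)

variable {E : Type*} [TopologicalSpace E] [Nonempty E]

/-- The value at time `s` of a path `ω` given on `(0, t)`, recovered as the limit of the values of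
`ω` at grid points decreasing to `s`. It agrees with `ω s` where `ω` is right-continuous, and unlike
`(ω, s) ↦ ω s` it is jointly measurable for the product `σ`-algebra on paths. -/
noncomputable def pathEval (ht : 0 < t) (ω : Set.Ioo 0 t → E) (s : ℝ) : E :=
  limUnder atTop fun n : ℕ => ω (gridPoint ht n ⌊((n : ℝ) + 1) * s⌋₊)

theorem pathEval_eq [T2Space E] (ht : 0 < t) {x : ℝ → E} {s : ℝ} (hs : s ∈ Set.Ioo 0 t)
    (hx : Tendsto x (𝓝[>] s) (𝓝 (x s))) : pathEval ht (fun r => x r) s = x s :=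
  (hx.comp (tendsto_gridPoint_nhdsGT ht hs)).limUnder_eq

theorem measurable_pathEval [TopologicalSpace.IsCompletelyMetrizableSpace E]
    [SecondCountableTopology E] [MeasurableSpace E] [BorelSpace E] (ht : 0 < t) :
    Measurable fun q : (Set.Ioo 0 t → E) × ℝ => pathEval ht q.1 q.2 := by
  refine StronglyMeasurable.measurable (StronglyMeasurable.limUnder fun n => ?_)
  refine Measurable.stronglyMeasurable ?_
  have h1 : Measurable fun q : (Set.Ioo 0 t → E) × ℕ => q.1 (gridPoint ht n q.2) :=
    measurable_from_prod_countable_left fun j => measurable_pi_apply (gridPoint ht n j)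
  have h2 : Measurable fun q : (Set.Ioo 0 t → E) × ℝ => (q.1, ⌊((n : ℝ) + 1) * q.2⌋₊) :=
    measurable_fst.prodMk (Nat.measurable_floor.comp (measurable_snd.const_mul _))
  exact h1.comp h2

end PathEvaluation

/-! ### The kernel of bridge laws on the path space -/

section PathLaw

variable {d : ℕ} {α t : ℝ} {W : Type*} [MeasurableSpace W] {X : ℝ → W → EuclideanSpace ℝ (Fin d)}

/-- The path `s ↦ X_s(w)` on the open time interval `(0, t)`. -/
def openPath {E : Type*} (X : ℝ → W → E) (t : ℝ) (w : W) : Set.Ioo 0 t → E := fun r => X r w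

theorem measurable_openPath {x y : EuclideanSpace ℝ (Fin d)} {μ : Measure W}
    (h : IsStableBridge d α t x y X μ) : Measurable (openPath X t) :=
  measurable_pi_lambda _ fun r => h.measurable r ⟨r.2.1.le, r.2.2.le⟩

theorem measurable_bridgeDensity (k : ℕ) (s : Fin (k + 1) → ℝ) :
    Measurable fun q : (EuclideanSpace ℝ (Fin d) × EuclideanSpace ℝ (Fin d)) ×
      (Fin (k + 1) → EuclideanSpace ℝ (Fin d)) => bridgeDensity d α t q.1.1 q.1.2 k s q.2 := by
  have hz : ∀ i : Fin (k + 1), Measurable fun q : (EuclideanSpace ℝ (Fin d) ×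
      EuclideanSpace ℝ (Fin d)) × (Fin (k + 1) → EuclideanSpace ℝ (Fin d)) => q.2 i := fun i =>
    (measurable_pi_apply i).comp measurable_snd
  have hx : Measurable fun q : (EuclideanSpace ℝ (Fin d) ×
      EuclideanSpace ℝ (Fin d)) × (Fin (k + 1) → EuclideanSpace ℝ (Fin d)) => q.1.1 :=
    measurable_fst.comp measurable_fst
  have hy : Measurable fun q : (EuclideanSpace ℝ (Fin d) ×
      EuclideanSpace ℝ (Fin d)) × (Fin (k + 1) → EuclideanSpace ℝ (Fin d)) => q.1.2 :=
    measurable_snd.comp measurable_fst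
  unfold bridgeDensity
  refine (((measurable_heatKernel measurable_const hx (hz _)).mul
    (Finset.measurable_fun_prod _ fun j _ =>
      measurable_heatKernel measurable_const (hz _) (hz _))).mul
    (measurable_heatKernel measurable_const (hz _) hy)).div
    (measurable_heatKernel measurable_const hx hy)

/-- The bridge probability of a cylinder set is an integral of the joint density. -/
theorem IsStableBridge.measure_forall_mem {x y : EuclideanSpace ℝ (Fin d)} {μ : Measure W}
    (h : IsStableBridge d α t x y X μ) {k : ℕ} {s : Fin (k + 1) → ℝ} (hs : StrictMono s)
    (hst : ∀ i, s i ∈ Set.Ioo 0 t) {C : Fin (k + 1) → Set (EuclideanSpace ℝ (Fin d))}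
    (hC : ∀ i, MeasurableSet (C i)) :
    μ {w | ∀ i, X (s i) w ∈ C i} =
      ∫⁻ z in Set.univ.pi C, ENNReal.ofReal (bridgeDensity d α t x y k s z) := by
  have hm : Measurable fun w i => X (s i) w :=
    measurable_pi_lambda _ fun i => h.measurable _ ⟨(hst i).1.le, (hst i).2.le⟩
  have hset : MeasurableSet (Set.univ.pi C) := MeasurableSet.univ_pi hC
  rw [← withDensity_apply _ hset, ← h.fdd k s hs hst, Measure.map_apply hm hset]
  congr 1
  ext w
  simp

/-- The law of the bridge, seen on paths over `(0, t)`, depends measurably on the end points. -/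
theorem measurable_map_openPath
    {Q : EuclideanSpace ℝ (Fin d) → EuclideanSpace ℝ (Fin d) → Measure W}
    (hQ : ∀ x y, IsStableBridge d α t x y X (Q x y)) :
    Measurable fun q : EuclideanSpace ℝ (Fin d) × EuclideanSpace ℝ (Fin d) =>
      (Q q.1 q.2).map (openPath X t) := by
  have hm : Measurable (openPath X t) := measurable_openPath (hQ 0 0)
  have hprob : ∀ q : EuclideanSpace ℝ (Fin d) × EuclideanSpace ℝ (Fin d),
      IsProbabilityMeasure ((Q q.1 q.2).map (openPath X t)) := fun q => by
    have := (hQ q.1 q.2).isProbabilityMeasure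
    exact Measure.isProbabilityMeasure_map hm.aemeasurable
  refine Measurable.measure_of_isPiSystem_of_isProbabilityMeasure
    generateFrom_squareCylinders.symm
    (isPiSystem_squareCylinders (fun _ => MeasurableSpace.isPiSystem_measurableSet)
      (by simp)) ?_
  rintro _ ⟨S, C, hC, rfl⟩
  have hC' : ∀ r, MeasurableSet (C r) := fun r => hC r (Set.mem_univ r)
  rcases Nat.eq_zero_or_eq_succ_pred S.card with h0 | h1
  · rw [Finset.card_eq_zero.1 h0]
    simp
  -- the times of the cylinder are listed in increasing order
  set e := S.orderEmbOfFin h1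
  have hs : StrictMono fun i => (e i : ℝ) := fun i j hij => e.strictMono hij
  have hval : ∀ q : EuclideanSpace ℝ (Fin d) × EuclideanSpace ℝ (Fin d),
      (Q q.1 q.2).map (openPath X t) ((S : Set (Set.Ioo 0 t)).pi C) =
        ∫⁻ z in Set.univ.pi fun i => C (e i),
          ENNReal.ofReal (bridgeDensity d α t q.1 q.2 _ (fun i => (e i : ℝ)) z) := by
    intro q
    rw [Measure.map_apply hm (MeasurableSet.pi S.countable_toSet fun r _ => hC' r),
      ← (hQ q.1 q.2).measure_forall_mem hs (fun i => (e i).2) fun i => hC' (e i)]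
    congr 1
    ext w
    have hrange : (S : Set (Set.Ioo 0 t)) = Set.range e := (S.range_orderEmbOfFin h1).symm
    simp [hrange, openPath]
  simp only [hval]
  exact (measurable_bridgeDensity _ _).ennreal_ofReal.lintegral_prod_right'

end PathLaw

/-! ### One-time marginals and positivity of the density -/

section Marginal

variable {d : ℕ} {α t : ℝ} {W : Type*} [MeasurableSpace W] {X : ℝ → W → EuclideanSpace ℝ (Fin d)}
  {x y : EuclideanSpace ℝ (Fin d)} {μ : Measure W}

/-- The law of `X_s` under the bridge measure has density `p_s(x, z) p_{t-s}(z, y) / p_t(x, y)`. -/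
theorem IsStableBridge.measure_mem (h : IsStableBridge d α t x y X μ) {s : ℝ}
    (hs : s ∈ Set.Ioo 0 t) {B : Set (EuclideanSpace ℝ (Fin d))} (hB : MeasurableSet B) :
    μ {w | X s w ∈ B} = ∫⁻ z in B,
      ENNReal.ofReal (heatKernel d α s x z * heatKernel d α (t - s) z y / heatKernel d α t x y) := by
  have h1 := h.measure_forall_mem (k := 0) (s := fun _ => s)
    (Subsingleton.strictMono (α := Fin 1) _) (fun _ => hs) (C := fun _ => B) (fun _ => hB)
  simp only [forall_const, bridgeDensity, Finset.univ_eq_empty, Finset.prod_empty, mul_one] at h1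
  rw [h1]
  have hmp := volume_preserving_funUnique (Fin 1) (EuclideanSpace ℝ (Fin d))
  have hpre : (Set.univ.pi fun _ : Fin 1 => B) =
      (MeasurableEquiv.funUnique (Fin 1) (EuclideanSpace ℝ (Fin d))) ⁻¹' B := by
    ext z
    simp
  rw [hpre]
  exact hmp.setLIntegral_comp_preimage_emb (MeasurableEquiv.measurableEmbedding _)
    (fun z => ENNReal.ofReal
      (heatKernel d α s x z * heatKernel d α (t - s) z y / heatKernel d α t x y)) B

/-- The one-time marginals of a bridge are probability measures with a density that is divided by
`p_t(x, y)`, so this number cannot vanish. -/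
theorem IsStableBridge.heatKernel_ne_zero (ht : 0 < t) (h : IsStableBridge d α t x y X μ) :
    heatKernel d α t x y ≠ 0 := by
  intro h0
  have := h.isProbabilityMeasure
  have h1 := h.measure_mem (s := t / 2) ⟨half_pos ht, half_lt_self ht⟩ MeasurableSet.univ
  simp [h0] at h1

end Marginal

/-- A stable density without zeros is positive: it is continuous and positive at the origin. -/
theorem stableDensity_pos {d : ℕ} {α t : ℝ} (hd : 0 < d) (hα : 0 < α) (ht : 0 < t)
    (hne : ∀ z, stableDensity d α t z ≠ 0) (z : EuclideanSpace ℝ (Fin d)) :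
    0 < stableDensity d α t z := by
  by_contra! hz
  obtain ⟨z', hz'⟩ := mem_range_of_exists_le_of_exists_ge
    (continuous_stableDensity (d := d) hd hα ht) ⟨z, hz⟩ ⟨0, (stableDensity_zero_pos hd hα ht).le⟩
  exact hne z' hz'

/-! ### Occupation times as functionals of the path -/

section Occupation

variable {d : ℕ} {α t : ℝ} {W : Type*} [MeasurableSpace W] {X : ℝ → W → EuclideanSpace ℝ (Fin d)}
  {x y : EuclideanSpace ℝ (Fin d)} {μ : Measure W} {B D : Set (EuclideanSpace ℝ (Fin d))}

/-- The time that a path on `(0, t)`, evaluated by `pathEval`, spends in the set `B`. -/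
noncomputable def pathOccupation (ht : 0 < t) (B : Set (EuclideanSpace ℝ (Fin d)))
    (ω : Set.Ioo 0 t → EuclideanSpace ℝ (Fin d)) : ℝ :=
  ∫ s in Set.Ioo 0 t, B.indicator (fun _ => (1 : ℝ)) (pathEval ht ω s)

theorem measurable_indicator_pathEval (ht : 0 < t) (hB : MeasurableSet B) :
    Measurable fun q : (Set.Ioo 0 t → EuclideanSpace ℝ (Fin d)) × ℝ =>
      B.indicator (fun _ => (1 : ℝ)) (pathEval ht q.1 q.2) :=
  (measurable_const.indicator hB).comp (measurable_pathEval ht)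

theorem measurable_pathOccupation (ht : 0 < t) (hB : MeasurableSet B) :
    Measurable (pathOccupation ht B) :=
  ((measurable_indicator_pathEval ht hB).stronglyMeasurable.integral_prod_right').measurable

theorem indicator_one_nonneg (z : EuclideanSpace ℝ (Fin d)) :
    0 ≤ B.indicator (fun _ => (1 : ℝ)) z :=
  Set.indicator_nonneg (fun _ _ => zero_le_one) z

theorem pathOccupation_nonneg (ht : 0 < t) (ω : Set.Ioo 0 t → EuclideanSpace ℝ (Fin d)) :
    0 ≤ pathOccupation ht B ω :=
  integral_nonneg fun _ => indicator_one_nonneg _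

theorem pathOccupation_le (ht : 0 < t) (ω : Set.Ioo 0 t → EuclideanSpace ℝ (Fin d)) :
    pathOccupation ht B ω ≤ t := by
  have h := norm_setIntegral_le_of_norm_le_const (μ := volume) (s := Set.Ioo 0 t) (C := 1)
    (f := fun s => B.indicator (fun _ => (1 : ℝ)) (pathEval ht ω s)) (by simp) fun s _ => by
      rw [Real.norm_of_nonneg (indicator_one_nonneg _)]
      exact Set.indicator_le_self' (f := fun _ => (1 : ℝ)) (fun _ _ => zero_le_one) _
  rw [measureReal_def, Real.volume_Ioo, sub_zero, ENNReal.toReal_ofReal ht.le, one_mul] at h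
  exact (le_abs_self _).trans h

theorem IsStableBridge.integrable_pathOccupation (ht : 0 < t) (h : IsStableBridge d α t x y X μ)
    (hB : MeasurableSet B) : Integrable (fun w => pathOccupation ht B (openPath X t w)) μ := by
  have := h.isProbabilityMeasure
  have hm := (measurable_pathOccupation ht hB).comp (measurable_openPath h)
  refine Integrable.mono' (integrable_const t) hm.aestronglyMeasurable (ae_of_all _ fun w => ?_)
  rw [Real.norm_of_nonneg (pathOccupation_nonneg ht _)]
  exact pathOccupation_le ht _

theorem ofReal_pathOccupation (ht : 0 < t) (hB : MeasurableSet B)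
    (ω : Set.Ioo 0 t → EuclideanSpace ℝ (Fin d)) :
    ENNReal.ofReal (pathOccupation ht B ω) =
      ∫⁻ s in Set.Ioo 0 t, ((pathEval ht ω) ⁻¹' B).indicator 1 s := by
  have hm : Measurable fun s => B.indicator (fun _ => (1 : ℝ)) (pathEval ht ω s) := by
    have hω : Measurable (pathEval ht ω) := Measurable.of_uncurry_left (measurable_pathEval ht)
    have hind : Measurable (B.indicator fun _ => (1 : ℝ)) := measurable_const.indicator hB
    exact hind.comp hω
  rw [pathOccupation, ofReal_integral_eq_lintegral_ofReal _
    (ae_of_all _ fun _ => indicator_one_nonneg _)]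
  · refine lintegral_congr fun s => ?_
    by_cases hs : pathEval ht ω s ∈ B <;> simp [hs]
  · refine Integrable.mono' (integrable_const (1 : ℝ)) hm.aestronglyMeasurable
      (ae_of_all _ fun s => ?_)
    rw [Real.norm_of_nonneg (indicator_one_nonneg _)]
    exact Set.indicator_le_self' (f := fun _ => (1 : ℝ)) (fun _ _ => zero_le_one) _

theorem IsStableBridge.ae_pathEval_eq (ht : 0 < t) (h : IsStableBridge d α t x y X μ) :
    ∀ᵐ w ∂μ, ∀ s ∈ Set.Ioo 0 t, pathEval ht (openPath X t w) s = X s w := by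
  filter_upwards [h.rightCont] with w hw s hs
  exact pathEval_eq (x := fun r => X r w) ht hs (hw s ⟨hs.1.le, hs.2⟩)

/-- The occupation time of `D` is almost surely a functional of the path on `(0, t)`. Modifying `D`
on a null set is harmless: at each fixed time the bridge has a density, so by Fubini it spends
almost surely no time in a given null set. -/
theorem IsStableBridge.occupationTime_ae_eq (ht : 0 < t) (h : IsStableBridge d α t x y X μ)
    (hBD : B =ᵐ[volume] D) :
    ∀ᵐ w ∂μ, occupationTime X D t w = pathOccupation ht B (openPath X t w) := by
  have := h.isProbabilityMeasure
  -- a Borel null set containing the symmetric difference of `B` and `D`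
  obtain ⟨N, hNsub, hN, hN0⟩ := exists_measurable_superset_of_null (ae_iff.1 hBD.mem_iff)
  have hsN : ∀ s ∈ Set.Ioo 0 t, ∀ᵐ w ∂μ, pathEval ht (openPath X t w) s ∉ N := by
    intro s hs
    have h0 : ∀ᵐ w ∂μ, X s w ∉ N := by
      rw [ae_iff]
      simp only [not_not]
      rw [h.measure_mem hs hN, Measure.restrict_eq_zero.2 hN0, lintegral_zero_measure]
    filter_upwards [h.ae_pathEval_eq ht, h0] with w h1 h2
    rwa [h1 s hs]
  have hmeas : MeasurableSet {q : W × ℝ | pathEval ht (openPath X t q.1) q.2 ∉ N} :=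
    ((measurable_pathEval ht).comp (((measurable_openPath h).comp measurable_fst).prodMk
      measurable_snd) hN).compl
  have hfub : ∀ᵐ w ∂μ, ∀ᵐ s ∂volume.restrict (Set.Ioo 0 t),
      pathEval ht (openPath X t w) s ∉ N := by
    rw [Measure.ae_ae_comm hmeas]
    exact (ae_restrict_iff' measurableSet_Ioo).2 (ae_of_all _ hsN)
  filter_upwards [h.ae_pathEval_eq ht, hfub] with w h1 h2
  rw [occupationTime, intervalIntegral.integral_of_le ht.le, integral_Ioc_eq_integral_Ioo,
    pathOccupation]
  refine integral_congr_ae ?_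
  filter_upwards [h2, ae_restrict_mem measurableSet_Ioo] with s hsN hs
  rw [h1 s hs] at hsN ⊢
  have hiff : X s w ∈ B ↔ X s w ∈ D := by
    by_contra hne
    exact hsN (hNsub hne)
  by_cases hB : X s w ∈ B
  · rw [Set.indicator_of_mem hB, Set.indicator_of_mem (hiff.1 hB)]
  · rw [Set.indicator_of_notMem hB, Set.indicator_of_notMem (mt hiff.2 hB)]

theorem IsStableBridge.lintegral_pathOccupation (ht : 0 < t) (h : IsStableBridge d α t x y X μ)
    (hB : MeasurableSet B) :
    ∫⁻ w, ENNReal.ofReal (pathOccupation ht B (openPath X t w)) ∂μ =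
      ∫⁻ s in Set.Ioo 0 t, μ {w | X s w ∈ B} := by
  have := h.isProbabilityMeasure
  have hmeas : MeasurableSet {q : W × ℝ | pathEval ht (openPath X t q.1) q.2 ∈ B} :=
    (measurable_pathEval ht).comp (((measurable_openPath h).comp measurable_fst).prodMk
      measurable_snd) hB
  simp only [ofReal_pathOccupation ht hB]
  rw [lintegral_lintegral_swap]
  · refine setLIntegral_congr_fun measurableSet_Ioo fun s hs => ?_
    have hms : MeasurableSet {w | X s w ∈ B} := h.measurable s ⟨hs.1.le, hs.2.le⟩ hB
    rw [← lintegral_indicator_one hms]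
    refine lintegral_congr_ae ?_
    filter_upwards [h.ae_pathEval_eq ht] with w hw
    by_cases hX : X s w ∈ B <;> simp [hw s hs, hX]
  · exact ((measurable_one.indicator hmeas : Measurable ({q : W × ℝ | pathEval ht
      (openPath X t q.1) q.2 ∈ B}.indicator (1 : W × ℝ → ENNReal)))).aemeasurable

end Occupation

/-! ### Integration over the end points -/

section Total

variable {d : ℕ} {α t : ℝ} {W : Type*} [MeasurableSpace W] {X : ℝ → W → EuclideanSpace ℝ (Fin d)}
  {Q : EuclideanSpace ℝ (Fin d) → EuclideanSpace ℝ (Fin d) → Measure W}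
  {B : Set (EuclideanSpace ℝ (Fin d))}

/-- Expectations of measurable functionals of the path on `(0, t)` depend measurably on the end
points of the bridge. -/
theorem measurable_integral_pathOccupation (ht : 0 < t)
    (hQ : ∀ x y, IsStableBridge d α t x y X (Q x y)) (hB : MeasurableSet B) {F : ℝ → ℝ}
    (hF : Measurable F) :
    Measurable fun q : EuclideanSpace ℝ (Fin d) × EuclideanSpace ℝ (Fin d) =>
      ∫ w, F (pathOccupation ht B (openPath X t w)) ∂(Q q.1 q.2) := by
  let κ : ProbabilityTheory.Kernel (EuclideanSpace ℝ (Fin d) × EuclideanSpace ℝ (Fin d))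
    (Set.Ioo 0 t → EuclideanSpace ℝ (Fin d)) := ⟨_, measurable_map_openPath hQ⟩
  have hG : StronglyMeasurable fun ω => F (pathOccupation (d := d) ht B ω) :=
    (hF.comp (measurable_pathOccupation ht hB)).stronglyMeasurable
  have h : StronglyMeasurable fun q => ∫ ω, F (pathOccupation ht B ω) ∂κ q := hG.integral_kernel
  convert! h.measurable using 2 with q
  exact (integral_map (measurable_openPath (hQ q.1 q.2)).aemeasurable
    hG.aestronglyMeasurable).symm

theorem lintegral_heatKernel_left (hd : 0 < d) (hα : 0 < α) (ht : 0 < t)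
    (hpos : ∀ z, 0 < stableDensity d α t z) (z : EuclideanSpace ℝ (Fin d)) :
    ∫⁻ x, ENNReal.ofReal (heatKernel d α t x z) = 1 := by
  rw [← lintegral_stableDensity hd hα ht fun z => (hpos z).le]
  exact lintegral_sub_right_eq_self (fun x => ENNReal.ofReal (stableDensity d α t x)) z

theorem lintegral_heatKernel_right (hd : 0 < d) (hα : 0 < α) (ht : 0 < t)
    (hpos : ∀ z, 0 < stableDensity d α t z) (z : EuclideanSpace ℝ (Fin d)) :
    ∫⁻ y, ENNReal.ofReal (heatKernel d α t z y) = 1 := by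
  rw [← lintegral_stableDensity hd hα ht fun z => (hpos z).le]
  exact lintegral_sub_left_eq_self (fun x => ENNReal.ofReal (stableDensity d α t x)) z

/-- Tonelli's theorem: the integrals over `x` and `y` of the two kernels are one, which leaves the
Lebesgue measure of `(0, t) × B`. -/
theorem lintegral_heatKernel_mul_heatKernel (hd : 0 < d) (hα : 0 < α)
    (hpos : ∀ s, 0 < s → ∀ z, 0 < stableDensity d α s z) :
    ∫⁻ q : EuclideanSpace ℝ (Fin d) × EuclideanSpace ℝ (Fin d), ∫⁻ s in Set.Ioo 0 t, ∫⁻ z in B,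
      ENNReal.ofReal (heatKernel d α s q.1 z) * ENNReal.ofReal (heatKernel d α (t - s) z q.2) =
    ENNReal.ofReal t * volume B := by
  have hm : Measurable fun r : ((EuclideanSpace ℝ (Fin d) × EuclideanSpace ℝ (Fin d)) × ℝ) ×
      EuclideanSpace ℝ (Fin d) => ENNReal.ofReal (heatKernel d α r.1.2 r.1.1.1 r.2) *
        ENNReal.ofReal (heatKernel d α (t - r.1.2) r.2 r.1.1.2) := by
    have h1 : Measurable fun r : ((EuclideanSpace ℝ (Fin d) × EuclideanSpace ℝ (Fin d)) × ℝ) ×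
      EuclideanSpace ℝ (Fin d) => heatKernel d α r.1.2 r.1.1.1 r.2 :=
      measurable_heatKernel (by fun_prop) (by fun_prop) (by fun_prop)
    have h2 : Measurable fun r : ((EuclideanSpace ℝ (Fin d) × EuclideanSpace ℝ (Fin d)) × ℝ) ×
      EuclideanSpace ℝ (Fin d) => heatKernel d α (t - r.1.2) r.2 r.1.1.2 :=
      measurable_heatKernel (by fun_prop) (by fun_prop) (by fun_prop)
    exact h1.ennreal_ofReal.mul h2.ennreal_ofReal
  rw [lintegral_lintegral_swap]
  · have hinner : ∀ s ∈ Set.Ioo 0 t,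
        ∫⁻ q : EuclideanSpace ℝ (Fin d) × EuclideanSpace ℝ (Fin d), ∫⁻ z in B,
          ENNReal.ofReal (heatKernel d α s q.1 z) *
            ENNReal.ofReal (heatKernel d α (t - s) z q.2) = volume B := by
      intro s hs
      rw [lintegral_lintegral_swap]
      · have : ∀ z, ∫⁻ q : EuclideanSpace ℝ (Fin d) × EuclideanSpace ℝ (Fin d),
            ENNReal.ofReal (heatKernel d α s q.1 z) *
              ENNReal.ofReal (heatKernel d α (t - s) z q.2) = 1 := by
          intro z
          have h1 : Measurable fun x => heatKernel d α s x z :=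
            measurable_heatKernel measurable_const measurable_id measurable_const
          have h2 : Measurable fun y => heatKernel d α (t - s) z y :=
            measurable_heatKernel measurable_const measurable_const measurable_id
          rw [Measure.volume_eq_prod, lintegral_prod_mul h1.ennreal_ofReal.aemeasurable
            h2.ennreal_ofReal.aemeasurable, lintegral_heatKernel_left hd hα hs.1 (hpos s hs.1),
            lintegral_heatKernel_right hd hα (sub_pos.2 hs.2) (hpos _ (sub_pos.2 hs.2)), one_mul]
        simp only [this, lintegral_const, one_mul, Measure.restrict_apply_univ]
      · have h3 : Measurable fun r : (EuclideanSpace ℝ (Fin d) × EuclideanSpace ℝ (Fin d)) ×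
            EuclideanSpace ℝ (Fin d) => ((r.1, s), r.2) := by fun_prop
        exact (hm.comp h3).aemeasurable
    rw [setLIntegral_congr_fun measurableSet_Ioo hinner, lintegral_const,
      Measure.restrict_apply_univ, Real.volume_Ioo, sub_zero, mul_comm]
  · exact hm.lintegral_prod_right'.aemeasurable

/-- The first occupation moment in terms of `pathOccupation`; the factor `p_t(x, y)` cancels the
normalisation of the marginal densities. -/
theorem lintegral_heatKernel_mul_integral_pathOccupation (hd : 0 < d) (hα : 0 < α) (ht : 0 < t)
    (hQ : ∀ x y, IsStableBridge d α t x y X (Q x y)) (hB : MeasurableSet B)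
    (hpos : ∀ s, 0 < s → ∀ z, 0 < stableDensity d α s z) :
    ∫⁻ q : EuclideanSpace ℝ (Fin d) × EuclideanSpace ℝ (Fin d),
      ENNReal.ofReal (heatKernel d α t q.1 q.2 *
        ∫ w, pathOccupation ht B (openPath X t w) ∂(Q q.1 q.2)) =
    ENNReal.ofReal t * volume B := by
  rw [← lintegral_heatKernel_mul_heatKernel hd hα hpos]
  refine lintegral_congr fun q => ?_
  have h := hQ q.1 q.2
  have := h.isProbabilityMeasure
  have hp : 0 < heatKernel d α t q.1 q.2 := hpos t ht _
  have hi := h.integrable_pathOccupation ht hB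
  rw [ENNReal.ofReal_mul hp.le, ofReal_integral_eq_lintegral_ofReal hi
    (ae_of_all _ fun _ => pathOccupation_nonneg ht _), h.lintegral_pathOccupation ht hB,
    ← lintegral_const_mul' _ _ ENNReal.ofReal_ne_top]
  refine setLIntegral_congr_fun measurableSet_Ioo fun s hs => ?_
  rw [h.measure_mem hs hB, ← lintegral_const_mul' _ _ ENNReal.ofReal_ne_top]
  refine lintegral_congr fun z => ?_
  rw [← ENNReal.ofReal_mul hp.le, mul_div_cancel₀ _ hp.ne', ENNReal.ofReal_mul]
  exact (hpos s hs.1 _).le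

end Total

end StableHeat

theorem mainTheorem4 (d : ℕ) (hd : 2 ≤ d) (α : ℝ) (hα0 : 0 < α) (hα2 : α ≤ 2)
    {W : Type*} [MeasurableSpace W] (X : ℝ → W → EuclideanSpace ℝ (Fin d))
    (P : ℝ → EuclideanSpace ℝ (Fin d) → EuclideanSpace ℝ (Fin d) → Measure W)
    (hP : ∀ t : ℝ, 0 < t → ∀ x y : EuclideanSpace ℝ (Fin d),
      StableHeat.IsStableBridge d α t x y X (P t x y))
    (D : Set (EuclideanSpace ℝ (Fin d))) (hD : NullMeasurableSet D volume)
    (hDfin : volume D < ⊤) (t : ℝ) (ht : 0 ≤ t) :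
    (Integrable (fun q : EuclideanSpace ℝ (Fin d) × EuclideanSpace ℝ (Fin d) =>
        StableHeat.heatContentIntegrand d α X P D t q.1 q.2) volume ∧
      0 ≤ StableHeat.schrodingerHeatContent d α X P D t ∧
      StableHeat.schrodingerHeatContent d α X P D t ≤ t * (volume D).toReal) ∧
    (Integrable (fun q : EuclideanSpace ℝ (Fin d) × EuclideanSpace ℝ (Fin d) =>
        StableHeat.occupationMomentIntegrand d α X P D 1 t q.1 q.2) volume ∧
      StableHeat.occupationMoment d α X P D 1 t = t * (volume D).toReal) := by
  open StableHeat in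
  have hd0 : 0 < d := by omega
  rcases ht.eq_or_lt with rfl | ht
  · -- at time zero the defining integral of the kernel diverges, so the kernel has the value zero
    have h0 : ∀ x y, heatKernel d α 0 x y = 0 := fun x y => stableDensity_zero_time hd0 _
    simp [schrodingerHeatContent, occupationMoment, heatContentIntegrand,
      occupationMomentIntegrand, h0]
  have hpos : ∀ s, 0 < s → ∀ z, 0 < stableDensity d α s z := fun s hs =>
    stableDensity_pos hd0 hα0 hs fun z => by
      simpa [heatKernel] using (hP s hs z 0).heatKernel_ne_zero hs
  have hQ := hP t ht
  obtain ⟨B, hB, hBD⟩ : ∃ B, MeasurableSet B ∧ B =ᵐ[volume] D :=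
    ⟨toMeasurable volume D, measurableSet_toMeasurable _ _, hD.toMeasurable_ae_eq⟩
  set m : EuclideanSpace ℝ (Fin d) × EuclideanSpace ℝ (Fin d) → ℝ := fun q =>
    heatKernel d α t q.1 q.2 * ∫ w, pathOccupation ht B (openPath X t w) ∂(P t q.1 q.2) with hm
  set g : EuclideanSpace ℝ (Fin d) × EuclideanSpace ℝ (Fin d) → ℝ := fun q =>
    heatKernel d α t q.1 q.2 *
      (1 - ∫ w, Real.exp (-pathOccupation ht B (openPath X t w)) ∂(P t q.1 q.2)) with hg
  have hm_eq : ∀ x y, occupationMomentIntegrand d α X P D 1 t x y = m (x, y) := by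
    intro x y
    rw [occupationMomentIntegrand, hm]
    congr 1
    refine integral_congr_ae ?_
    filter_upwards [(hQ x y).occupationTime_ae_eq ht hBD] with w hw
    rw [hw, pow_one]
  have hg_eq : ∀ x y, heatContentIntegrand d α X P D t x y = g (x, y) := by
    intro x y
    rw [heatContentIntegrand, hg]
    congr 2
    refine integral_congr_ae ?_
    filter_upwards [(hQ x y).occupationTime_ae_eq ht hBD] with w hw
    rw [hw]
  have hp : Measurable fun q : EuclideanSpace ℝ (Fin d) × EuclideanSpace ℝ (Fin d) =>
      heatKernel d α t q.1 q.2 := measurable_heatKernel measurable_const measurable_fst measurable_snd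
  have hm_meas : Measurable m :=
    hp.mul (measurable_integral_pathOccupation ht hQ hB measurable_id)
  have hg_meas : Measurable g :=
    hp.mul (measurable_const.sub (measurable_integral_pathOccupation ht hQ hB
      (F := fun a => Real.exp (-a)) (by fun_prop)))
  have hm_nonneg : ∀ q, 0 ≤ m q := fun q => mul_nonneg (hpos t ht _).le
    (integral_nonneg fun w => pathOccupation_nonneg ht _)
  have hbounds : ∀ q, 0 ≤ g q ∧ g q ≤ m q := by
    intro q
    have h := hQ q.1 q.2
    have := h.isProbabilityMeasure
    have hmw := (measurable_pathOccupation ht hB).comp (measurable_openPath h)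
    have hi := h.integrable_pathOccupation ht hB
    have he : Integrable (fun w => Real.exp (-pathOccupation ht B (openPath X t w)))
        (P t q.1 q.2) :=
      Integrable.mono' (integrable_const (1 : ℝ)) hmw.neg.exp.aestronglyMeasurable
        (ae_of_all _ fun w => by
          rw [Real.norm_of_nonneg (Real.exp_pos _).le, Real.exp_le_one_iff, neg_nonpos]
          exact pathOccupation_nonneg ht _)
    have h1 : ∫ w, Real.exp (-pathOccupation ht B (openPath X t w)) ∂(P t q.1 q.2) ≤ 1 := by
      have := integral_mono he (integrable_const (1 : ℝ)) fun w => by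
        rw [Real.exp_le_one_iff, neg_nonpos]
        exact pathOccupation_nonneg ht _
      simpa using this
    -- the inequality `1 - exp (-a) ≤ a`, in expectation
    have h2 : 1 - ∫ w, pathOccupation ht B (openPath X t w) ∂(P t q.1 q.2) ≤
        ∫ w, Real.exp (-pathOccupation ht B (openPath X t w)) ∂(P t q.1 q.2) := by
      have := integral_mono ((integrable_const (1 : ℝ)).sub hi) he fun w =>
        Real.one_sub_le_exp_neg (pathOccupation ht B (openPath X t w))
      rw [integral_sub' (integrable_const _) hi] at this
      simpa using this
    exact ⟨mul_nonneg (hpos t ht _).le (sub_nonneg.2 h1),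
      mul_le_mul_of_nonneg_left (by linarith) (hpos t ht _).le⟩
  have hlint : ∫⁻ q, ENNReal.ofReal (m q) = ENNReal.ofReal t * volume D := by
    rw [← measure_congr hBD]
    exact lintegral_heatKernel_mul_integral_pathOccupation hd0 hα0 ht hQ hB hpos
  have hm_int : Integrable m volume := by
    refine ⟨hm_meas.aestronglyMeasurable, ?_⟩
    rw [hasFiniteIntegral_iff_ofReal (ae_of_all _ hm_nonneg), hlint]
    exact ENNReal.mul_lt_top ENNReal.ofReal_lt_top hDfin
  have hm_val : ∫ q, m q = t * (volume D).toReal := by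
    rw [integral_eq_lintegral_of_nonneg_ae (ae_of_all _ hm_nonneg) hm_meas.aestronglyMeasurable,
      hlint, ENNReal.toReal_mul, ENNReal.toReal_ofReal ht.le]
  have hg_int : Integrable g volume :=
    hm_int.mono' hg_meas.aestronglyMeasurable (ae_of_all _ fun q => by
      rw [Real.norm_of_nonneg (hbounds q).1]
      exact (hbounds q).2)
  have hΨ : schrodingerHeatContent d α X P D t = ∫ q, g q := by
    simp only [schrodingerHeatContent, hg_eq]
    exact (integral_prod g hg_int).symm
  have hT : occupationMoment d α X P D 1 t = ∫ q, m q := by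
    simp only [occupationMoment, hm_eq]
    exact (integral_prod m hm_int).symm
  simp only [hg_eq, hm_eq, hΨ, hT]
  exact ⟨⟨hg_int, integral_nonneg fun q => (hbounds q).1,
    (integral_mono hg_int hm_int fun q => (hbounds q).2).trans_eq hm_val⟩, hm_int, hm_val⟩
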